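/- For real $\alpha$ with $|\alpha|<1$, let $am(\cdot,\alpha):\mathbb R\to\mathbb R$ be the inverse function of $\phi\mapsto\int_0^{\phi}\frac{dt}{\sqrt{1-\alpha^2\sin^2 t}}$, and let $cn(u,\alpha)=\cos am(u,\alpha)$ be the Jacobi elliptic function. (1) There is exactly one sequence of polynomials $c_n(q)\in\mathbb R[q]$, $n\ge 0$, such that for every $\alpha$ with $|\alpha|<1$ $$cn(u,\alpha)=\sum_{n\ge 0}(-1)^n c_n(\alpha^2)\frac{u^{2n}}{(2n)!}$$ for all $u$ in a neighbourhood of $0$. (2) For all $n,k\ge 0$, the coefficient of $q^k$ in $c_n(q)$ is the number of alternating permutations $\pi(1)>\pi(2)<\pi(3)>\cdots$ of $[2n]=\{1,\dots,2n\}$ having exactly $k$ minima of even value. Here a minimum is a letter $\pi(i)$ that is smaller than each of its neighbours in the word $\pi(1)\cdots\pi(2n)$; an end letter has only one neighbour. (3) The sequence $\{c_n(q)\}_{n\ge 0}$ is $3$-$q$-log-convex: for every $0\le m\le 3$, all polynomials of the sequence $\mathcal L^m\{c_n(q)\}$ have only nonnegative coefficients, where $\mathcal L$ maps a sequence of polynomials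 $\{f_i(q)\}_{i\ge s}$ to the sequence $\{f_{i-1}(q)f_{i+1}(q)-f_i(q)^2\}_{i\ge s+1}$. -/

import Mathlib

open scoped Polynomial

/-- The sequence operator `f ↦ (f_{i-1} f_{i+1} - f_i ^ 2)_{i ≥ 1}` on polynomial sequences,
reindexed so that the new sequence again starts at index `0`. -/
noncomputable def logConvexOp (f : ℕ → ℝ[X]) : ℕ → ℝ[X] :=
  fun i => f i * f (i + 2) - f (i + 1) ^ 2

/-- `k`-`q`-log-convexity: for all `m ≤ k`, every polynomial of the `m`-th iterate of
`logConvexOp` (including the sequence itself, `m = 0`) has only nonnegative coefficients. -/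
def IsQLogConvex (k : ℕ) (f : ℕ → ℝ[X]) : Prop :=
  ∀ m ≤ k, ∀ i j : ℕ, 0 ≤ ((logConvexOp^[m] f) i).coeff j

/-- The incomplete elliptic integral of the first kind with modulus `α`. -/
noncomputable def ellipticF (α φ : ℝ) : ℝ :=
  ∫ t in (0 : ℝ)..φ, 1 / √(1 - α ^ 2 * Real.sin t ^ 2)

/-- The Jacobi amplitude `am(u, α)`, the inverse function of `φ ↦ ellipticF α φ`
(which is a bijection of `ℝ` when `|α| < 1`). -/
noncomputable def jacobiAm (α u : ℝ) : ℝ :=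
  Function.invFun (ellipticF α) u

/-- The Jacobi elliptic function `cn(u, α) = cos am(u, α)`. -/
noncomputable def jacobiCn (α u : ℝ) : ℝ :=
  Real.cos (jacobiAm α u)

/-- `c_n(q)`, `n ≥ 0`, are the Taylor coefficient polynomials of `cn`: for every modulus
`-1 < α < 1`, `cn(u, α) = ∑ (-1) ^ n c_n(α ^ 2) u ^ (2 n) / (2 n)!` for `u` near `0`. -/
def IsCnTaylorSequence (c : ℕ → ℝ[X]) : Prop :=
  ∀ α : ℝ, |α| < 1 → ∀ᶠ u in nhds (0 : ℝ),
    HasSum (fun n : ℕ => (-1 : ℝ) ^ n * (c n).eval (α ^ 2) * u ^ (2 * n) /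
      (Nat.factorial (2 * n) : ℝ)) (jacobiCn α u)

/-- A permutation of `{0, …, N - 1}`, read as the word `σ 0, σ 1, …`, is alternating when
`σ 0 > σ 1 < σ 2 > σ 3 < ⋯`. -/
def IsAlternatingPerm {N : ℕ} (σ : Equiv.Perm (Fin N)) : Prop :=
  ∀ i j : Fin N, (j : ℕ) = i + 1 →
    (Even (i : ℕ) → σ j < σ i) ∧ (Odd (i : ℕ) → σ i < σ j)

/-- The letter of `σ` at position `i` is a minimum: it is smaller than each of its
neighbours in the word (an end letter has only one neighbour). -/
def IsPermMinimum {N : ℕ} (σ : Equiv.Perm (Fin N)) (i : Fin N) : Prop :=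
  ∀ j : Fin N, ((j : ℕ) = i + 1 ∨ (i : ℕ) = j + 1) → σ i < σ j

/-- The number of minima of even value; the letter `σ i` in `{0, …, N - 1}` stands for the
value `σ i + 1` in `{1, …, N}`. -/
noncomputable def evenMinimaCount {N : ℕ} (σ : Equiv.Perm (Fin N)) : ℕ :=
  Set.ncard {i : Fin N | IsPermMinimum σ i ∧ Even ((σ i : ℕ) + 1)}

/-! Everything rests on one infinite tridiagonal matrix `B = L U`, where `L` is lower bidiagonal
(diagonal `2k+1`, subdiagonal `2k+2`) and `U` is upper bidiagonal (diagonal `2k+1`, superdiagonal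
`2k q`). With `cnMoment n` the row vector `δ₀ Bⁿ`, the polynomials sought are its entries at index
`0`.

Analysis: on the functions `(-1)ᵏ sn²ᵏ cn` the operator `-d²/du²` acts as `B` at `q = α²`
(`hasDerivAt_snPowCnDeriv`). Iterating from `cn` and evaluating at `0`, where only `k = 0` survives,
gives the Taylor coefficients. A bound on the entries of `δ₀ Bⁿ` makes the remainder tend to zero
(`isCnTaylorSequence_cnMoment`). Uniqueness is that of power series, together with the fact that
`α²` takes infinitely many values.

Combinatorics: an alternating permutation is built by adding its letters in increasing order, each
new letter either filling an open peak or splitting one by a valley. Counting by open peaks, one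
even and one odd letter together act as `L` and then `U` (`cnMoment_eq_wordPolynomial`).

Positivity: bidiagonal factors with coefficientwise nonnegative entries preserve total positivity,
so all Hankel minors of the moments have nonnegative coefficients (`isTotallyPositiveBelow_hankel`).
Determinant identities express the iterates of `logConvexOp` up to the third through these minors
(`isQLogConvex_three_of_hankel`). -/

/-- Every minor of `A` with rows below `M` lies in the subsemiring `S`. -/
def IsTotallyPositiveBelow {R : Type*} [CommRing R] (S : Subsemiring R) (M : ℕ)
    (A : ℕ → ℕ → R) : Prop :=
  ∀ (m : ℕ) (r c : Fin m → ℕ), StrictMono r → StrictMono c → (∀ i, r i < M) →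
    (Matrix.of fun i j => A (r i) (c j)).det ∈ S

/-! ### Total positivity over a subsemiring, and Hankel matrices of moments. -/

section TotalPositivity

variable {R : Type*} [CommRing R] {S : Subsemiring R} {M : ℕ} {A : ℕ → ℕ → R}

/-- A repeated column makes the determinant zero, so weakly increasing column choices are harmless.
Such choices arise when column combinations are expanded. -/
theorem IsTotallyPositiveBelow.det_mem_of_monotone (hA : IsTotallyPositiveBelow S M A) {m : ℕ}
    {r c : Fin m → ℕ} (hr : StrictMono r) (hc : Monotone c) (hM : ∀ i, r i < M) :
    (Matrix.of fun i j => A (r i) (c j)).det ∈ S := by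
  by_cases hinj : Function.Injective c
  · exact hA m r c hr (hc.strictMono_of_injective hinj) hM
  · obtain ⟨i, j, hij, hne⟩ : ∃ i j, c i = c j ∧ i ≠ j := by
      simpa [Function.Injective] using hinj
    rw [Matrix.det_zero_of_column_eq hne (fun k => by simp [hij])]
    exact S.zero_mem

/-- Total positivity is preserved by right multiplication with a bidiagonal-like matrix: each new
column combines two old columns, and the column pairs are interlaced. -/
theorem IsTotallyPositiveBelow.combine_columns (hA : IsTotallyPositiveBelow S M A)
    {a b : ℕ → R} {p p' : ℕ → ℕ} (ha : ∀ k, a k ∈ S) (hb : ∀ k, b k ∈ S)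
    (hp : ∀ k, p k ≤ p' k) (hp' : ∀ k, p' k ≤ p (k + 1)) :
    IsTotallyPositiveBelow S M (fun i j => a j * A i (p j) + b j * A i (p' j)) := by
  intro m r c hr hc hM
  have hpm : Monotone p := monotone_nat_of_le_succ fun k => (hp k).trans (hp' k)
  have hlt : ∀ {j j' : ℕ}, j < j' → p' j ≤ p j' := fun {j j'} h => (hp' j).trans (hpm h)
  rw [← Matrix.det_transpose]
  have key : (Matrix.of fun i j => a (c j) * A (r i) (p (c j)) +
      b (c j) * A (r i) (p' (c j))).transpose
      = (fun j => a (c j) • fun i => A (r i) (p (c j))) +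
        (fun j => b (c j) • fun i => A (r i) (p' (c j))) := by
    ext i j; simp
  change (Matrix.detRowAlternating : (Fin m → R) [⋀^Fin m]→ₗ[R] R) _ ∈ S
  rw [key]
  have hadd := (Matrix.detRowAlternating : (Fin m → R) [⋀^Fin m]→ₗ[R] R).toMultilinearMap.map_add_univ
    (fun j => a (c j) • fun i => A (r i) (p (c j)))
    (fun j => b (c j) • fun i => A (r i) (p' (c j)))
  simp only [AlternatingMap.coe_multilinearMap] at hadd
  rw [hadd]
  -- Multilinearity gives one term per set `s` of columns that take their first summand; the
  -- coefficients then factor out.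
  refine S.sum_mem fun s _ => ?_
  have hpw : s.piecewise (fun j => a (c j) • fun i => A (r i) (p (c j)))
      (fun j => b (c j) • fun i => A (r i) (p' (c j)))
      = fun j => (if j ∈ s then a (c j) else b (c j)) •
        (fun i => A (r i) (if j ∈ s then p (c j) else p' (c j))) := by
    ext j i
    by_cases hj : j ∈ s <;> simp [hj]
  rw [hpw]
  have hsm := (Matrix.detRowAlternating : (Fin m → R) [⋀^Fin m]→ₗ[R] R).toMultilinearMap.map_smul_univ
    (fun j => if j ∈ s then a (c j) else b (c j))
    (fun j i => A (r i) (if j ∈ s then p (c j) else p' (c j)))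
  simp only [AlternatingMap.coe_multilinearMap] at hsm
  rw [hsm, smul_eq_mul]
  refine S.mul_mem (S.prod_mem fun j _ => by split_ifs <;> simp [ha, hb]) ?_
  -- Interlacing keeps the chosen column indices in weak order, whatever `s` is.
  have hmono : Monotone fun j => if j ∈ s then p (c j) else p' (c j) := by
    intro j j' hjj'
    rcases hjj'.eq_or_lt with rfl | hlt'
    · exact le_rfl
    · have h1 := hlt (hc hlt')
      have h2 := hp (c j)
      have h3 := hp (c j')
      dsimp only
      split_ifs <;> omega
  have := hA.det_mem_of_monotone hr hmono hM
  rw [← Matrix.det_transpose] at this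
  exact this

/-- Prepending the first unit vector as a new top row preserves total positivity. -/
theorem IsTotallyPositiveBelow.of_tail (h0 : ∀ k, A 0 k = if k = 0 then 1 else 0)
    (hA : IsTotallyPositiveBelow S M (fun i => A (i + 1))) :
    IsTotallyPositiveBelow S (M + 1) A := by
  intro m r c hr hc hM
  have hshift : ∀ {k : ℕ} {r' c' : Fin k → ℕ}, StrictMono r' → StrictMono c' →
      (∀ i, r' i < M + 1) → (∀ i, 0 < r' i) →
      (Matrix.of fun i j => A (r' i) (c' j)).det ∈ S := by
    intro k r' c' hr' hc' hM' hpos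
    have := hA k (fun i => r' i - 1) c'
      (fun i j hij => by have := hr' hij; have := hpos i; dsimp only; omega) hc'
      (fun i => by have := hM' i; have := hpos i; omega)
    have he : ∀ i, r' i - 1 + 1 = r' i := fun i => Nat.sub_add_cancel (hpos i)
    simpa only [he] using this
  rcases m with _ | m
  · simp
  · by_cases hr0 : r 0 = 0
    · rw [Matrix.det_succ_row_zero]
      refine S.sum_mem fun j _ => ?_
      simp only [Matrix.of_apply, hr0, h0]
      rcases Fin.eq_zero_or_eq_succ j with rfl | ⟨j', rfl⟩
      · refine S.mul_mem (S.mul_mem (by simp) (by split_ifs <;> simp)) ?_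
        exact hshift (hr.comp (Fin.strictMono_succ))
          (hc.comp (Fin.strictMono_succAbove 0)) (fun i => hM _)
          (fun i => by have := hr (Fin.succ_pos i); omega)
      · have : c j'.succ ≠ 0 := by have := hc (Fin.succ_pos j'); omega
        simp [this]
    · refine hshift hr hc hM fun i => ?_
      have := hr.monotone (Fin.zero_le i)
      omega

/-- The row vector `g` multiplied by the lower bidiagonal matrix with diagonal `l` and
subdiagonal `l'`. -/
def lowerBidiag (l l' : ℕ → R) (g : ℕ → R) : ℕ → R := fun k => l k * g k + l' k * g (k + 1)

/-- The row vector `g` multiplied by the upper bidiagonal matrix with diagonal `u` and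
superdiagonal `u' 1, u' 2, …`. -/
def upperBidiag (u u' : ℕ → R) (g : ℕ → R) : ℕ → R := fun k => u' k * g (k - 1) + u k * g k

variable {l l' u u' : ℕ → R}

theorem IsTotallyPositiveBelow.bidiag (hl : ∀ k, l k ∈ S) (hl' : ∀ k, l' k ∈ S)
    (hu : ∀ k, u k ∈ S) (hu' : ∀ k, u' k ∈ S) (hA : IsTotallyPositiveBelow S M A) :
    IsTotallyPositiveBelow S M (fun i => upperBidiag u u' (lowerBidiag l l' (A i))) := by
  have h1 := hA.combine_columns (p := id) (p' := fun k => k + 1) hl hl' (fun k => Nat.le_succ k)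
    (fun k => le_rfl)
  exact h1.combine_columns (p := fun k => k - 1) (p' := id) hu' hu (fun k => Nat.sub_le k 1)
    (fun k => le_rfl)

/-- The matrix whose rows are the iterates of the unit vector under `B` is totally positive. -/
theorem isTotallyPositiveBelow_iterate (hl : ∀ k, l k ∈ S) (hl' : ∀ k, l' k ∈ S)
    (hu : ∀ k, u k ∈ S) (hu' : ∀ k, u' k ∈ S) (M : ℕ) :
    IsTotallyPositiveBelow S M
      (fun i => (fun g => upperBidiag u u' (lowerBidiag l l' g))^[i] (Pi.single 0 1)) := by
  induction M with
  | zero =>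
    intro m r c hr hc hM
    rcases m with _ | m
    · simp
    · exact absurd (hM 0) (Nat.not_lt_zero _)
  | succ M ih =>
    refine IsTotallyPositiveBelow.of_tail (fun k => by simp [Pi.single_apply]) ?_
    simp only [Function.iterate_succ_apply']
    exact ih.bidiag hl hl' hu hu'

/-- Interpolates between `A` and the matrix of first entries: columns `j ≤ m` already hold entry `0`
of `A Bʲ`, and the later ones hold `A Bᵐ` shifted by `m`. Passing to `m + 1` multiplies only the
shifted block by `L` and `U`. The shift by one keeps the old column `m` while still combining
adjacent columns. -/
theorem IsTotallyPositiveBelow.first_entries_truncated (hl : ∀ k, l k ∈ S) (hl' : ∀ k, l' k ∈ S)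
    (hu : ∀ k, u k ∈ S) (hu' : ∀ k, u' k ∈ S) (hu0 : u' 0 = 0) (hA : IsTotallyPositiveBelow S M A) (m : ℕ) :
    IsTotallyPositiveBelow S M (fun i j =>
      (fun g => upperBidiag u u' (lowerBidiag l l' g))^[min j m] (A i) (j - m)) := by
  induction m with
  | zero => simpa using hA
  | succ m ih =>
    have h1 := ih.combine_columns (a := fun j => if j ≤ m then 0 else l (j - (m + 1)))
      (b := fun j => if j ≤ m then 1 else l' (j - (m + 1)))
      (p := fun j => j - 1) (p' := id)
      (fun k => by split_ifs <;> simp [hl]) (fun k => by split_ifs <;> simp [hl'])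
      (fun k => Nat.sub_le k 1) (fun k => le_rfl)
    have h2 := h1.combine_columns
      -- At `j = m + 1` the left neighbour is a finished column outside the block. Its coefficient
      -- must be `0`, which agrees with `upperBidiag` because `u' 0 = 0`.
      (a := fun j => if j ≤ m + 1 then 0 else u' (j - (m + 1)))
      (b := fun j => if j ≤ m then 1 else u (j - (m + 1)))
      (p := fun j => j - 1) (p' := id)
      (fun k => by split_ifs <;> simp [hu']) (fun k => by split_ifs <;> simp [hu])
      (fun k => Nat.sub_le k 1) (fun k => le_rfl)
    refine (congrArg (IsTotallyPositiveBelow S M) (funext₂ fun i j => ?_)).mp h2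
    rcases Nat.lt_trichotomy j (m + 1) with hj | rfl | hj
    · have h3 : j ≤ m + 1 := by omega
      have h4 : j ≤ m := by omega
      simp [h3, h4, Nat.sub_eq_zero_of_le]
    · simp [Function.iterate_succ_apply', upperBidiag, lowerBidiag, hu0]
    · obtain ⟨k, rfl⟩ : ∃ k, j = m + 2 + k := ⟨j - (m + 2), by omega⟩
      have e1 : ¬ m + 2 + k ≤ m + 1 := by omega
      have e2 : ¬ m + 2 + k ≤ m := by omega
      have e3 : ¬ m + 2 + k - 1 ≤ m := by omega
      have e4 : m + 2 + k - (m + 1) = k + 1 := by omega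
      have e5 : m + 2 + k - 1 - (m + 1) = k := by omega
      have e6 : m + 2 + k - 1 - 1 - m = k := by omega
      have e7 : m + 2 + k - 1 - m = k + 1 := by omega
      have e8 : m + 2 + k - m = k + 2 := by omega
      have f1 : min (m + 2 + k) (m + 1) = m + 1 := by omega
      have f2 : min (m + 2 + k) m = m := by omega
      have f3 : min (m + 2 + k - 1) m = m := by omega
      have f4 : min (m + 2 + k - 1 - 1) m = m := by omega
      simp only [id, e1, e2, e3, e4, e5, e6, e7, e8, f1, f2, f3, f4, if_false,
        Function.iterate_succ_apply', upperBidiag, lowerBidiag, Nat.add_sub_cancel]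

/-- If `A` is totally positive then so is the matrix of the first entries of the iterates of its
rows under `B`, the iteration number being the column index. -/
theorem IsTotallyPositiveBelow.first_entries (hl : ∀ k, l k ∈ S) (hl' : ∀ k, l' k ∈ S)
    (hu : ∀ k, u k ∈ S) (hu' : ∀ k, u' k ∈ S) (hu0 : u' 0 = 0)
    (hA : IsTotallyPositiveBelow S M A) :
    IsTotallyPositiveBelow S M (fun i j =>
      (fun g => upperBidiag u u' (lowerBidiag l l' g))^[j] (A i) 0) := by
  intro m r c hr hc hM
  -- Taking `m` at least every selected column index puts the whole minor in the finished region.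
  have h := hA.first_entries_truncated hl hl' hu hu' hu0 (Finset.univ.sup c) m r c hr hc hM
  have hle : ∀ j, c j ≤ Finset.univ.sup c := fun j => Finset.le_sup (Finset.mem_univ j)
  simpa only [min_eq_left (hle _), Nat.sub_eq_zero_of_le (hle _)] using h

/-- The Hankel matrix of the moments `(Bⁿ)₀₀` of a product `B` of bidiagonal matrices with
entries in `S` has all its minors in `S`. -/
theorem isTotallyPositiveBelow_hankel (hl : ∀ k, l k ∈ S) (hl' : ∀ k, l' k ∈ S)
    (hu : ∀ k, u k ∈ S) (hu' : ∀ k, u' k ∈ S) (hu0 : u' 0 = 0) (M : ℕ) :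
    IsTotallyPositiveBelow S M (fun i j =>
      (fun g => upperBidiag u u' (lowerBidiag l l' g))^[i + j] (Pi.single 0 1) 0) := by
  have h := (isTotallyPositiveBelow_iterate hl hl' hu hu' M).first_entries hl hl' hu hu' hu0
  intro m r c hr hc hM
  have := h m r c hr hc hM
  simpa only [← Function.iterate_add_apply, Nat.add_comm] using this

end TotalPositivity

/-! ### From Hankel minors to iterated `q`-log-convexity. -/

/-- The polynomials with nonnegative coefficients. -/
def nonnegCoeff : Subsemiring ℝ[X] where
  carrier := {f | ∀ j, 0 ≤ f.coeff j}
  mul_mem' {f g} hf hg j := by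
    rw [Polynomial.coeff_mul]
    exact Finset.sum_nonneg fun x _ => mul_nonneg (hf _) (hg _)
  one_mem' j := by
    rw [Polynomial.coeff_one]
    split_ifs <;> norm_num
  add_mem' {f g} hf hg j := by
    rw [Polynomial.coeff_add]
    exact add_nonneg (hf j) (hg j)
  zero_mem' j := by simp

theorem mem_nonnegCoeff {f : ℝ[X]} : f ∈ nonnegCoeff ↔ ∀ j, 0 ≤ f.coeff j := Iff.rfl

theorem X_mem_nonnegCoeff : (Polynomial.X : ℝ[X]) ∈ nonnegCoeff := fun j => by
  rw [Polynomial.coeff_X]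
  split_ifs <;> norm_num

/-- A sequence of polynomials whose Hankel minors have nonnegative coefficients is
`3`-`q`-log-convex. -/
theorem isQLogConvex_three_of_hankel {f : ℕ → ℝ[X]}
    (hf : ∀ M, IsTotallyPositiveBelow nonnegCoeff M (fun i j => f (i + j))) :
    IsQLogConvex 3 f := by
  have hminor : ∀ n i : ℕ, (Matrix.of fun a b : Fin n => f (i + a + b)).det ∈ nonnegCoeff :=
    fun n i => hf (i + n) n (fun a => i + a) (fun b => b)
      (fun a b hab => by simpa using hab) (fun a b hab => hab) (fun a => by simp)
  have h1 : ∀ i, f i ∈ nonnegCoeff := fun i => by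
    simpa [Matrix.det_fin_one] using hminor 1 i
  have h2 : ∀ i, logConvexOp f i ∈ nonnegCoeff := fun i => by
    have := hminor 2 i
    rw [Matrix.det_fin_two] at this
    convert this using 1
    simp [logConvexOp]
    ring
  have h3 := hminor 3
  have h4 := hminor 4
  -- The Desnanot–Jacobi identity for a `3 × 3` Hankel determinant, whose central entry is `f (i +
  -- 2)`.
  have e3 : ∀ i, logConvexOp (logConvexOp f) i =
      f (i + 2) * (Matrix.of fun a b : Fin 3 => f (i + a + b)).det := fun i => by
    rw [Matrix.det_fin_three]
    simp [logConvexOp, Nat.add_assoc]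
    ring
  -- Substitute `e3` and write `f (i+2) * f (i+4)` as `logConvexOp f (i+2) + f (i+3) ^ 2`.
  -- Desnanot–Jacobi for the `4 × 4` determinant, with central minor `logConvexOp f (i+2)`, handles
  -- the remaining difference.
  have e4 : ∀ i, logConvexOp (logConvexOp (logConvexOp f)) i =
      logConvexOp f (i + 2) * ((Matrix.of fun a b : Fin 3 => f (i + a + b)).det *
        (Matrix.of fun a b : Fin 3 => f (i + 2 + a + b)).det +
        f (i + 3) ^ 2 * (Matrix.of fun a b : Fin 4 => f (i + a + b)).det) := fun i => by
    rw [logConvexOp, e3, e3, e3, Matrix.det_succ_row_zero (n := 3)]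
    simp only [Matrix.det_fin_three, Fin.sum_univ_four]
    simp [logConvexOp, Nat.add_assoc, Fin.succAbove, Fin.lt_def, Fin.succ, Fin.castSucc]
    ring
  intro m hm i
  rw [← mem_nonnegCoeff]
  interval_cases m
  · exact h1 i
  · exact h2 i
  · change logConvexOp (logConvexOp f) i ∈ _
    rw [e3]
    exact nonnegCoeff.mul_mem (h1 _) (h3 i)
  · change logConvexOp (logConvexOp (logConvexOp f)) i ∈ _
    rw [e4]
    exact nonnegCoeff.mul_mem (h2 _) (nonnegCoeff.add_mem (nonnegCoeff.mul_mem (h3 i) (h3 _))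
      (nonnegCoeff.mul_mem (nonnegCoeff.pow_mem (h1 _) 2) (h4 i)))

/-! ### Partial alternating words

An alternating word `p₁ > v₁ < p₂ > v₂ < ⋯` is stored as the list of the pairs `(pᵢ, vᵢ)`. In a
partial word some of the peaks `pᵢ` are still undetermined, which is recorded as `⊤`. -/

/-- Pairs consisting of a (possibly undetermined) peak and the valley that follows it. -/
abbrev PeakValley : Type := WithTop ℕ × ℕ

/-- The first peak of a partial word. -/
def firstPeak : List PeakValley → WithTop ℕ
  | [] => ⊤
  | a :: _ => a.1

/-- Every valley is smaller than the two adjacent peaks. -/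
def IsZigzag : List PeakValley → Prop
  | [] => True
  | a :: l => (a.2 : WithTop ℕ) < a.1 ∧ (a.2 : WithTop ℕ) < firstPeak l ∧ IsZigzag l

/-- The number of occurrences of the letter `i`. -/
def letterCount (i : ℕ) : List PeakValley → ℕ
  | [] => 0
  | a :: l => (if a.1 = i then 1 else 0) + (if a.2 = i then 1 else 0) + letterCount i l

/-- The number of undetermined peaks. -/
def openPeaks : List PeakValley → ℕ
  | [] => 0
  | a :: l => (if a.1 = ⊤ then 1 else 0) + openPeaks l

/-- The number of valleys which are odd, that is, of even value when letters are counted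
from `1`. -/
def oddValleys : List PeakValley → ℕ
  | [] => 0
  | a :: l => (if Odd a.2 then 1 else 0) + oddValleys l

/-- All ways to give the value `N` to an undetermined peak. -/
def peakFillings (N : ℕ) : List PeakValley → List (List PeakValley)
  | [] => []
  | a :: l => (if a.1 = ⊤ then [((N : WithTop ℕ), a.2) :: l] else []) ++
      (peakFillings N l).map (a :: ·)

/-- All ways to insert a valley `N` next to undetermined peaks. -/
def valleyInsertions (N : ℕ) : List PeakValley → List (List PeakValley)
  | [] => [[(⊤, N)]]
  | a :: l => (if a.1 = ⊤ then [(⊤, N) :: a :: l] else []) ++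
      (valleyInsertions N l).map (a :: ·)

/-- The words obtained from `l` by adding the letter `N`. -/
def extensions (N : ℕ) (l : List PeakValley) : List (List PeakValley) :=
  peakFillings N l ++ valleyInsertions N l

/-- The partial words with letters `0, …, N - 1`. -/
def partialWords : ℕ → List (List PeakValley)
  | 0 => [[]]
  | N + 1 => (partialWords N).flatMap (extensions N)

/-- Remove the letter `N` from a partial word. -/
def removeLetter (N : ℕ) : List PeakValley → List PeakValley
  | [] => []
  | a :: l => if a.2 = N then l else if a.1 = N then (⊤, a.2) :: l else a :: removeLetter N l

/-- A filling alters a single pair and copies everything before it, so a property need only be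
checked at that pair and under a common head. -/
theorem peakFillings_induction {N : ℕ} {P : List PeakValley → List PeakValley → Prop}
    (fill : ∀ v l, P ((⊤, v) :: l) (((N : WithTop ℕ), v) :: l))
    (cons : ∀ a l c, c ∈ peakFillings N l → P l c → P (a :: l) (a :: c)) :
    ∀ l c, c ∈ peakFillings N l → P l c := by
  intro l
  induction l with
  | nil => intro c hc; simp [peakFillings] at hc
  | cons a l ih =>
    obtain ⟨p, v⟩ := a
    intro c hc
    rw [peakFillings, List.mem_append] at hc
    rcases hc with hc | hc
    · split_ifs at hc with hp
      · obtain rfl := List.mem_singleton.mp hc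
        obtain rfl : p = ⊤ := hp
        exact fill v l
      · simp at hc
    · obtain ⟨c', hc', rfl⟩ := List.mem_map.mp hc
      exact cons _ _ _ hc' (ih _ hc')

theorem valleyInsertions_induction {N : ℕ} {P : List PeakValley → List PeakValley → Prop}
    (insert : ∀ l, firstPeak l = ⊤ → P l ((⊤, N) :: l))
    (cons : ∀ a l c, c ∈ valleyInsertions N l → P l c → P (a :: l) (a :: c)) :
    ∀ l c, c ∈ valleyInsertions N l → P l c := by
  intro l
  induction l with
  | nil =>
    intro c hc
    obtain rfl := List.mem_singleton.mp hc
    exact insert [] rfl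
  | cons a l ih =>
    intro c hc
    rw [valleyInsertions, List.mem_append] at hc
    rcases hc with hc | hc
    · split_ifs at hc with hp
      · obtain rfl := List.mem_singleton.mp hc
        exact insert _ hp
      · simp at hc
    · obtain ⟨c', hc', rfl⟩ := List.mem_map.mp hc
      exact cons _ _ _ hc' (ih _ hc')

section Extensions

variable {N : ℕ} {l c : List PeakValley}

theorem letterCount_extensions (i : ℕ) (hc : c ∈ extensions N l) :
    letterCount i c = letterCount i l + if i = N then 1 else 0 := by
  rcases List.mem_append.mp hc with hc | hc
  · refine peakFillings_induction (P := fun l c => letterCount i c = letterCount i l +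
      if i = N then 1 else 0) (fun v l => ?_) (fun a l c _ h => ?_) l c hc
    · simp only [letterCount, WithTop.top_ne_natCast, if_false, Nat.cast_inj, eq_comm (a := N)]
      omega
    · simp only [letterCount, h]; omega
  · refine valleyInsertions_induction (P := fun l c => letterCount i c = letterCount i l +
      if i = N then 1 else 0) (fun l _ => ?_) (fun a l c _ h => ?_) l c hc
    · simp only [letterCount, WithTop.top_ne_natCast, if_false, eq_comm (a := N)]
      omega
    · simp only [letterCount, h]; omega

theorem openPeaks_peakFillings (hc : c ∈ peakFillings N l) :
    openPeaks c + 1 = openPeaks l := by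
  refine peakFillings_induction (P := fun l c => openPeaks c + 1 = openPeaks l)
    (fun v l => ?_) (fun a l c _ h => ?_) l c hc
  · simp [openPeaks]; omega
  · simp only [openPeaks, ← h]; omega

theorem openPeaks_valleyInsertions (hc : c ∈ valleyInsertions N l) :
    openPeaks c = openPeaks l + 1 := by
  refine valleyInsertions_induction (P := fun l c => openPeaks c = openPeaks l + 1)
    (fun l _ => ?_) (fun a l c _ h => ?_) l c hc
  · simp [openPeaks]; omega
  · simp only [openPeaks, h]; omega

theorem oddValleys_peakFillings (hc : c ∈ peakFillings N l) :
    oddValleys c = oddValleys l := by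
  refine peakFillings_induction (P := fun l c => oddValleys c = oddValleys l)
    (fun v l => ?_) (fun a l c _ h => ?_) l c hc
  · simp [oddValleys]
  · simp only [oddValleys, h]

theorem oddValleys_valleyInsertions (hc : c ∈ valleyInsertions N l) :
    oddValleys c = oddValleys l + if Odd N then 1 else 0 := by
  refine valleyInsertions_induction (P := fun l c => oddValleys c = oddValleys l +
    if Odd N then 1 else 0) (fun l _ => ?_) (fun a l c _ h => ?_) l c hc
  · simp only [oddValleys]; omega
  · simp only [oddValleys, h]; omega

theorem length_peakFillings (N : ℕ) (l : List PeakValley) :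
    (peakFillings N l).length = openPeaks l := by
  induction l with
  | nil => rfl
  | cons a l ih =>
    simp only [peakFillings, openPeaks, List.length_append, List.length_map, ih]
    split_ifs <;> rfl

theorem length_valleyInsertions (N : ℕ) (l : List PeakValley) :
    (valleyInsertions N l).length = openPeaks l + 1 := by
  induction l with
  | nil => rfl
  | cons a l ih =>
    simp only [valleyInsertions, openPeaks, List.length_append, List.length_map, ih]
    split_ifs <;> simp; omega

theorem firstPeak_extensions (hc : c ∈ extensions N l) :
    firstPeak c = firstPeak l ∨ (firstPeak l = ⊤ ∧ firstPeak c = N) := by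
  rcases List.mem_append.mp hc with hc | hc
  · exact peakFillings_induction (P := fun l c => firstPeak c = firstPeak l ∨
      (firstPeak l = ⊤ ∧ firstPeak c = N)) (fun v l => Or.inr ⟨rfl, rfl⟩)
      (fun a l c _ h => Or.inl rfl) l c hc
  · exact valleyInsertions_induction (P := fun l c => firstPeak c = firstPeak l ∨
      (firstPeak l = ⊤ ∧ firstPeak c = N)) (fun l h => Or.inl h.symm)
      (fun a l c _ h => Or.inl rfl) l c hc

/-- Letters arrive in increasing order: a filled peak exceeds the valleys already placed, and a new
valley has only undetermined peaks beside it. -/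
theorem IsZigzag.extensions (hl : IsZigzag l) (hN : ∀ i, N ≤ i → letterCount i l = 0)
    (hc : c ∈ extensions N l) : IsZigzag c := by
  have hcons : ∀ a l c, c ∈ _root_.extensions N l →
      (IsZigzag l → (∀ i, N ≤ i → letterCount i l = 0) → IsZigzag c) →
      IsZigzag (a :: l) → (∀ i, N ≤ i → letterCount i (a :: l) = 0) → IsZigzag (a :: c) := by
    intro a l c hc ih hl hN
    refine ⟨hl.1, ?_, ih hl.2.2 fun i hi => ?_⟩
    · rcases firstPeak_extensions hc with h | h
      · rw [h]; exact hl.2.1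
      · rw [h.2]
        by_contra! hlt
        have := hN a.2 (by exact_mod_cast hlt)
        simp [letterCount] at this
    · have := hN i hi
      simp only [letterCount] at this
      omega
  revert hl hN
  rcases List.mem_append.mp hc with hc | hc
  · refine peakFillings_induction (P := fun l c => IsZigzag l →
      (∀ i, N ≤ i → letterCount i l = 0) → IsZigzag c) (fun v l hl hN => ?_)
      (fun a l c hc ih => hcons a l c (List.mem_append_left _ hc) ih) l c hc
    refine ⟨?_, hl.2⟩
    by_contra! hlt
    have := hN v ((Nat.cast_le (α := WithTop ℕ)).mp hlt)
    simp [letterCount] at this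
  · refine valleyInsertions_induction (P := fun l c => IsZigzag l →
      (∀ i, N ≤ i → letterCount i l = 0) → IsZigzag c) (fun l h hl hN => ?_)
      (fun a l c hc ih => hcons a l c (List.mem_append_right _ hc) ih) l c hc
    exact ⟨WithTop.natCast_lt_top N, by rw [h]; exact WithTop.natCast_lt_top N, hl⟩

theorem removeLetter_extensions (hN : letterCount N l = 0) (hc : c ∈ extensions N l) :
    removeLetter N c = l := by
  have hcons : ∀ a l c, (letterCount N l = 0 → removeLetter N c = l) →
      letterCount N (a :: l) = 0 → removeLetter N (a :: c) = a :: l := by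
    intro a l c ih h
    simp only [letterCount] at h
    have h1 : a.1 ≠ N := fun e => by simp [e] at h
    have h2 : a.2 ≠ N := fun e => by simp [e] at h
    simp only [removeLetter, h1, h2, if_false]
    rw [ih (by omega)]
  revert hN
  rcases List.mem_append.mp hc with hc | hc
  · refine peakFillings_induction (P := fun l c => letterCount N l = 0 → removeLetter N c = l)
      (fun v l h => ?_) (fun a l c _ ih => hcons a l c ih) l c hc
    have h2 : v ≠ N := fun e => by simp [letterCount, e] at h
    simp [removeLetter, h2]
  · refine valleyInsertions_induction
      (P := fun l c => letterCount N l = 0 → removeLetter N c = l)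
      (fun l _ h => ?_) (fun a l c _ ih => hcons a l c ih) l c hc
    simp [removeLetter]

theorem nodup_extensions (hN : letterCount N l = 0) : (extensions N l).Nodup := by
  refine List.nodup_append.mpr ⟨?_, ?_, fun a ha b hb hab => ?_⟩
  · clear hN
    induction l with
    | nil => simp [peakFillings]
    | cons a l ih =>
      rw [peakFillings]
      refine List.nodup_append.mpr ⟨by split_ifs <;> simp, ih.map (List.cons_injective),
        fun x hx y hy hxy => ?_⟩
      obtain ⟨c, -, rfl⟩ := List.mem_map.mp hy
      split_ifs at hx with hp
      · rw [List.mem_singleton.mp hx] at hxy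
        have := congrArg firstPeak hxy
        simp [firstPeak, hp] at this
      · simp at hx
  · induction l with
    | nil => simp [valleyInsertions]
    | cons a l ih =>
      simp only [letterCount] at hN
      rw [valleyInsertions]
      refine List.nodup_append.mpr ⟨by split_ifs <;> simp,
        (ih (by omega)).map (List.cons_injective), fun x hx y hy hxy => ?_⟩
      obtain ⟨c, -, rfl⟩ := List.mem_map.mp hy
      split_ifs at hx with hp
      · rw [List.mem_singleton.mp hx] at hxy
        have := (List.cons.inj hxy).1
        simp [← this] at hN
      · simp at hx
  · subst hab
    have h1 := openPeaks_peakFillings ha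
    have h2 := openPeaks_valleyInsertions hb
    omega

/-- Delete the largest letter. If it is a valley, both adjacent peaks exceed it and are therefore
open, so its pair can be dropped; if it is a peak, reopen it. -/
theorem exists_mem_extensions (hc : IsZigzag c) (hN : letterCount N c = 1)
    (hgt : ∀ i, N < i → letterCount i c = 0) :
    ∃ l, IsZigzag l ∧ c ∈ extensions N l := by
  induction c with
  | nil => simp [letterCount] at hN
  | cons a c ih =>
    obtain ⟨p, v⟩ := a
    obtain ⟨h1, h2, h3⟩ := hc
    dsimp only at h1 h2
    have htop : ∀ q : WithTop ℕ, (N : WithTop ℕ) < q → (∀ i : ℕ, q = i → letterCount i ((p, v) :: c) ≠ 0) →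
        q = ⊤ := by
      intro q hq hi
      induction q using WithTop.recTopCoe with
      | top => rfl
      | coe i => exact absurd (hgt i ((Nat.cast_lt (α := WithTop ℕ)).mp hq)) (hi i rfl)
    by_cases hv : v = N
    · subst hv
      have hfc : firstPeak c = ⊤ := by
        refine htop _ h2 fun i hi => ?_
        rcases c with _ | ⟨b, c⟩
        · simp [firstPeak] at hi
        · simp only [firstPeak] at hi
          simp [letterCount, hi]
      have hp : p = ⊤ := htop _ h1 fun i hi => by simp [letterCount, hi]
      subst hp
      refine ⟨c, h3, List.mem_append_right _ ?_⟩
      rcases c with _ | ⟨b, c⟩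
      · simp [valleyInsertions]
      · simp only [firstPeak] at hfc
        simp [valleyInsertions, hfc]
    · by_cases hp : p = N
      · subst hp
        exact ⟨(⊤, v) :: c, ⟨WithTop.natCast_lt_top v, h2, h3⟩,
          List.mem_append_left _ (by simp [peakFillings])⟩
      · obtain ⟨l, hl, hlc⟩ := ih h3 (by simpa [letterCount, hv, hp] using hN)
          (fun i hi => by have := hgt i hi; simp only [letterCount] at this; omega)
        refine ⟨(p, v) :: l, ⟨h1, ?_, hl⟩, ?_⟩
        · rcases firstPeak_extensions hlc with h | h
          · rw [← h]; exact h2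
          · rw [h.1]; exact WithTop.natCast_lt_top v
        · rcases List.mem_append.mp hlc with h | h
          · exact List.mem_append_left _ (List.mem_append_right _ (List.mem_map_of_mem h))
          · exact List.mem_append_right _ (List.mem_append_right _ (List.mem_map_of_mem h))

end Extensions

theorem mem_partialWords {N : ℕ} {l : List PeakValley} :
    l ∈ partialWords N ↔ IsZigzag l ∧ ∀ i, letterCount i l = if i < N then 1 else 0 := by
  induction N generalizing l with
  | zero =>
    simp only [partialWords, List.mem_singleton, Nat.not_lt_zero, if_false]
    constructor
    · rintro rfl
      exact ⟨trivial, fun _ => rfl⟩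
    · rintro ⟨-, h⟩
      rcases l with _ | ⟨a, l⟩
      · rfl
      · have := h a.2
        simp [letterCount] at this
  | succ N ih =>
    simp only [partialWords, List.mem_flatMap]
    constructor
    · rintro ⟨l', hl', hl⟩
      obtain ⟨hz, hcount⟩ := ih.mp hl'
      refine ⟨hz.extensions (fun i hi => by rw [hcount, if_neg (by omega)]) hl, fun i => ?_⟩
      rw [letterCount_extensions i hl, hcount]
      split_ifs <;> omega
    · rintro ⟨hz, hcount⟩
      obtain ⟨l', hz', hl'⟩ := exists_mem_extensions (N := N) hz (by simp [hcount])
        (fun i hi => by rw [hcount, if_neg (by omega)])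
      refine ⟨l', ih.mpr ⟨hz', fun i => ?_⟩, hl'⟩
      have h1 := letterCount_extensions i hl'
      rw [hcount] at h1
      split_ifs at h1 ⊢ <;> omega

theorem nodup_partialWords (N : ℕ) : (partialWords N).Nodup := by
  induction N with
  | zero => simp [partialWords]
  | succ N ih =>
    have hzero : ∀ l ∈ partialWords N, letterCount N l = 0 := fun l hl => by
      rw [(mem_partialWords.mp hl).2, if_neg (lt_irrefl N)]
    refine List.nodup_flatMap.mpr ⟨fun l hl => nodup_extensions (hzero l hl), ?_⟩
    refine ih.pairwise_of_forall_ne fun l hl l' hl' hne => ?_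
    intro c hc hc'
    exact hne ((removeLetter_extensions (hzero l hl) hc).symm.trans
      (removeLetter_extensions (hzero l' hl') hc'))

/-! ### Enumeration of partial words by the tridiagonal matrix. -/

/-- The generating polynomial, by odd valleys, of the partial words with letters
`0, …, N - 1` and `h` undetermined peaks. -/
noncomputable def wordPolynomial (N h : ℕ) : ℝ[X] :=
  ((partialWords N).map fun l => if openPeaks l = h then Polynomial.X ^ oddValleys l else 0).sum

theorem wordPolynomial_zero (h : ℕ) : wordPolynomial 0 h = if h = 0 then 1 else 0 := by
  simp [wordPolynomial, partialWords, openPeaks, oddValleys, eq_comm]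

/-- Reaching `h` open peaks means filling one of `h + 1`, or splitting one of `h`: the `h - 1` open
peaks and the virtual one after the last valley. At `h = 0` the factor `h` cancels the truncated
index. -/
theorem wordPolynomial_succ (N h : ℕ) :
    wordPolynomial (N + 1) h = ((h : ℝ[X]) + 1) * wordPolynomial N (h + 1) +
      (h : ℝ[X]) * Polynomial.X ^ (if Odd N then 1 else 0) * wordPolynomial N (h - 1) := by
  unfold wordPolynomial
  rw [partialWords]
  induction partialWords N with
  | nil => simp
  | cons l L ih =>
    rw [List.flatMap_cons, List.map_append, List.sum_append, ih]
    simp only [List.map_cons, List.sum_cons]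
    have h1 : ((peakFillings N l).map fun c => if openPeaks c = h then
        (Polynomial.X : ℝ[X]) ^ oddValleys c else 0).sum =
        ((h : ℝ[X]) + 1) * if openPeaks l = h + 1 then Polynomial.X ^ oddValleys l else 0 := by
      rw [List.map_congr_left (g := fun _ => if openPeaks l = h + 1 then
        (Polynomial.X : ℝ[X]) ^ oddValleys l else 0) (fun c hc => ?_)]
      · rw [List.map_const', List.sum_replicate, length_peakFillings, nsmul_eq_mul]
        split_ifs with he
        · rw [he]; push_cast; ring
        · simp
      · rw [oddValleys_peakFillings hc, ← openPeaks_peakFillings hc]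
        simp
    have h2 : ((valleyInsertions N l).map fun c => if openPeaks c = h then
        (Polynomial.X : ℝ[X]) ^ oddValleys c else 0).sum =
        (h : ℝ[X]) * Polynomial.X ^ (if Odd N then 1 else 0) *
          if openPeaks l = h - 1 then Polynomial.X ^ oddValleys l else 0 := by
      rw [List.map_congr_left (g := fun _ => if openPeaks l + 1 = h then
        (Polynomial.X : ℝ[X]) ^ (oddValleys l + if Odd N then 1 else 0) else 0)
        (fun c hc => ?_)]
      · rw [List.map_const', List.sum_replicate, length_valleyInsertions, nsmul_eq_mul]
        rcases h with _ | h
        · simp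
        · simp only [Nat.add_right_cancel_iff, Nat.add_sub_cancel]
          split_ifs with he
          · rw [he]; push_cast; ring
          · rw [he]; push_cast; ring
          all_goals simp
      · rw [oddValleys_valleyInsertions hc, openPeaks_valleyInsertions hc]
    rw [extensions, List.map_append, List.sum_append, h1, h2]
    ring

/-- The row vectors `δ₀ Bⁿ`, where `B` is the tridiagonal matrix of the Stieltjes continued
fraction with coefficients `1², 2² q, 3², 4² q, …`. -/
noncomputable def cnMoment (n : ℕ) : ℕ → ℝ[X] :=
  (fun g => upperBidiag (fun k => 2 * (k : ℝ[X]) + 1) (fun k => 2 * (k : ℝ[X]) * Polynomial.X)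
    (lowerBidiag (fun k => 2 * (k : ℝ[X]) + 1) (fun k => 2 * (k : ℝ[X]) + 2) g))^[n]
    (Pi.single 0 1)

/-- An even letter leads from even to odd numbers of open peaks with weight `1`, giving `L`; the odd
letter after it leads back, with `q` marking new valleys, giving `U`. -/
theorem cnMoment_eq_wordPolynomial (n k : ℕ) :
    cnMoment n k = wordPolynomial (2 * n) (2 * k) := by
  induction n generalizing k with
  | zero => simp [cnMoment, wordPolynomial_zero, Pi.single_apply]
  | succ n ih =>
    have hodd : ∀ k, wordPolynomial (2 * n + 1) (2 * k + 1) =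
        lowerBidiag (fun k => 2 * (k : ℝ[X]) + 1) (fun k => 2 * (k : ℝ[X]) + 2) (cnMoment n) k := fun k => by
      rw [wordPolynomial_succ, lowerBidiag, ih, ih, if_neg (by simp)]
      simp only [Nat.add_sub_cancel, show 2 * k + 1 + 1 = 2 * (k + 1) by ring]
      push_cast
      ring
    rw [cnMoment, Function.iterate_succ_apply', ← cnMoment, show 2 * (n + 1) = 2 * n + 1 + 1 by ring,
      wordPolynomial_succ, hodd, upperBidiag, if_pos (by simp)]
    rcases k with _ | k
    · simp
    · rw [show 2 * (k + 1) - 1 = 2 * k + 1 by omega, hodd, Nat.add_sub_cancel]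
      push_cast
      ring

theorem isQLogConvex_cnMoment : IsQLogConvex 3 fun n => cnMoment n 0 := by
  have hnat : ∀ n : ℕ, (n : ℝ[X]) ∈ nonnegCoeff := fun n => natCast_mem nonnegCoeff n
  have h1 : ∀ k : ℕ, 2 * (k : ℝ[X]) + 1 ∈ nonnegCoeff :=
    fun k => by exact_mod_cast hnat (2 * k + 1)
  have h2 : ∀ k : ℕ, 2 * (k : ℝ[X]) + 2 ∈ nonnegCoeff :=
    fun k => by exact_mod_cast hnat (2 * k + 2)
  have h3 : ∀ k : ℕ, 2 * (k : ℝ[X]) * Polynomial.X ∈ nonnegCoeff := fun k =>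
    nonnegCoeff.mul_mem (by exact_mod_cast hnat (2 * k)) X_mem_nonnegCoeff
  exact isQLogConvex_three_of_hankel
    (isTotallyPositiveBelow_hankel h1 h2 h1 h3 (by simp))

/-! ### Complete words as alternating permutations. -/

theorem isZigzag_iff_getElem {l : List PeakValley} :
    IsZigzag l ↔ (∀ (i : ℕ) (hi : i < l.length), ((l[i].2 : ℕ) : WithTop ℕ) < l[i].1) ∧
      ∀ (i : ℕ) (hi : i + 1 < l.length), ((l[i].2 : ℕ) : WithTop ℕ) < l[i + 1].1 := by
  induction l with
  | nil => simp [IsZigzag]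
  | cons a l ih =>
    rw [IsZigzag, ih]
    constructor
    · rintro ⟨h1, h2, h3, h4⟩
      refine ⟨fun i hi => ?_, fun i hi => ?_⟩
      · rcases i with _ | i
        · exact h1
        · exact h3 i (by simpa using hi)
      · rcases i with _ | i
        · rcases l with _ | ⟨b, l⟩
          · simp at hi
          · exact h2
        · exact h4 i (by simpa using hi)
    · rintro ⟨h1, h2⟩
      refine ⟨h1 0 (by simp), ?_, fun i hi => h1 (i + 1) (by simpa using hi),
        fun i hi => h2 (i + 1) (by simpa using hi)⟩
      rcases l with _ | ⟨b, l⟩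
      · exact WithTop.natCast_lt_top _
      · exact h2 0 (by simp)

theorem letterCount_ofFn (i : ℕ) {n : ℕ} (f : Fin n → PeakValley) :
    letterCount i (List.ofFn f) =
      ∑ j, ((if (f j).1 = i then 1 else 0) + (if (f j).2 = i then 1 else 0)) := by
  induction n with
  | zero => simp [letterCount]
  | succ n ih => rw [List.ofFn_succ, letterCount, ih, Fin.sum_univ_succ]

theorem openPeaks_ofFn {n : ℕ} (f : Fin n → PeakValley) :
    openPeaks (List.ofFn f) = ∑ j, if (f j).1 = ⊤ then 1 else 0 := by
  induction n with
  | zero => simp [openPeaks]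
  | succ n ih => rw [List.ofFn_succ, openPeaks, ih, Fin.sum_univ_succ]

theorem oddValleys_ofFn {n : ℕ} (f : Fin n → PeakValley) :
    oddValleys (List.ofFn f) = ∑ j, if Odd (f j).2 then 1 else 0 := by
  induction n with
  | zero => simp [oddValleys]
  | succ n ih => rw [List.ofFn_succ, oddValleys, ih, Fin.sum_univ_succ]

theorem two_mul_length_eq {M : ℕ} {l : List PeakValley} (hl : ∀ i, M ≤ i → letterCount i l = 0) :
    2 * l.length = openPeaks l + ∑ i ∈ Finset.range M, letterCount i l := by
  induction l with
  | nil => simp [openPeaks, letterCount]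
  | cons a l ih =>
    obtain ⟨p, v⟩ := a
    have hv : v < M := by
      by_contra! h
      have := hl v h
      simp [letterCount] at this
    simp only [letterCount, openPeaks, List.length_cons, Finset.sum_add_distrib]
    rw [Nat.mul_add, ih fun i hi => by have := hl i hi; simp only [letterCount] at this; omega]
    have h1 : ∑ i ∈ Finset.range M, (if v = i then 1 else 0) = 1 := by simp [hv]
    have h2 : (if p = ⊤ then 1 else 0) + ∑ i ∈ Finset.range M, (if p = (i : WithTop ℕ) then 1 else 0)
        = 1 := by
      induction p using WithTop.recTopCoe with
      | top => simp
      | coe j =>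
        have hj : j < M := by
          by_contra! h
          have := hl j h
          simp [letterCount] at this
        have : ∀ i : ℕ, ((j : WithTop ℕ) = i) = (j = i) := fun i => by
          rw [eq_iff_iff]; exact WithTop.coe_inj
        simp [this, hj]
    omega

theorem letterCount_pos {i : ℕ} {l : List PeakValley} (h : 0 < letterCount i l) :
    ∃ j, ∃ hj : j < l.length, l[j].1 = i ∨ l[j].2 = i := by
  induction l with
  | nil => simp [letterCount] at h
  | cons a l ih =>
    by_cases ha : a.1 = i ∨ a.2 = i
    · exact ⟨0, by simp, ha⟩
    · push Not at ha
      obtain ⟨j, hj, h'⟩ := ih (by simpa [letterCount, ha.1, ha.2] using h)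
      exact ⟨j + 1, by simpa using hj, h'⟩

theorem letterCount_getElem_pos {l : List PeakValley} {j : ℕ} (hj : j < l.length) {i : ℕ}
    (h : l[j].1 = i ∨ l[j].2 = i) : 0 < letterCount i l := by
  induction l generalizing j with
  | nil => simp at hj
  | cons a l ih =>
    rcases j with _ | j
    · simp only [List.getElem_cons_zero] at h
      rcases h with h | h <;> simp [letterCount, h]
    · have := ih (j := j) (by simpa using hj) h
      simp only [letterCount]
      omega

/-- The list of consecutive letter pairs of a permutation. -/
def pairWord {n : ℕ} (σ : Equiv.Perm (Fin (2 * n))) : List PeakValley :=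
  List.ofFn fun j : Fin n => (((σ ⟨2 * j, by omega⟩ : ℕ) : WithTop ℕ), (σ ⟨2 * j + 1, by omega⟩ : ℕ))

section PairWord

variable {n : ℕ} {σ : Equiv.Perm (Fin (2 * n))}

theorem pairWord_injective : Function.Injective (pairWord (n := n)) := by
  intro σ τ h
  have h' := List.ofFn_injective h
  ext x
  obtain ⟨j, hj | hj⟩ : ∃ j : ℕ, (x : ℕ) = 2 * j ∨ (x : ℕ) = 2 * j + 1 :=
    ⟨x / 2, by omega⟩
  · have h1 := congrArg Prod.fst (congrFun h' ⟨j, by omega⟩)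
    have h2 : x = ⟨2 * j, by omega⟩ := Fin.ext hj
    rw [h2]
    exact Nat.cast_inj.mp h1
  · have h1 := congrArg Prod.snd (congrFun h' ⟨j, by omega⟩)
    have h2 : x = ⟨2 * j + 1, by omega⟩ := Fin.ext hj
    rw [h2]
    exact h1

theorem isZigzag_pairWord : IsZigzag (pairWord σ) ↔ IsAlternatingPerm σ := by
  rw [isZigzag_iff_getElem]
  simp only [pairWord, List.length_ofFn, List.getElem_ofFn, Nat.cast_lt, Fin.val_fin_lt]
  constructor
  · rintro ⟨h1, h2⟩ i j hij
    refine ⟨fun ⟨m, hm⟩ => ?_, fun ⟨m, hm⟩ => ?_⟩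
    · convert h1 m (by omega) using 2 <;> ext <;> simp <;> omega
    · convert h2 m (by omega) using 2 <;> ext <;> simp <;> omega
  · intro h
    refine ⟨fun i hi => (h _ _ rfl).1 (by simp), fun i hi => (h _ _ ?_).2 (by simp)⟩
    simp; ring

theorem sum_fin_two_mul (n : ℕ) (f : Fin (2 * n) → ℕ) :
    ∑ x, f x = ∑ j : Fin n, (f ⟨2 * j, by omega⟩ + f ⟨2 * j + 1, by omega⟩) := by
  have h : ∀ m (g : ℕ → ℕ), ∑ x ∈ Finset.range (2 * m), g x =
      ∑ j ∈ Finset.range m, (g (2 * j) + g (2 * j + 1)) := by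
    intro m g
    induction m with
    | zero => simp
    | succ m ih =>
      rw [show 2 * (m + 1) = 2 * m + 1 + 1 by ring, Finset.sum_range_succ, Finset.sum_range_succ,
        ih, Finset.sum_range_succ, add_assoc]
  have := h n fun x => if hx : x < 2 * n then f ⟨x, hx⟩ else 0
  rw [Finset.sum_range, Finset.sum_range] at this
  convert this using 2 with x _ j _
  · simp
  · rw [dif_pos, dif_pos]

theorem letterCount_pairWord (i : ℕ) :
    letterCount i (pairWord σ) = if i < 2 * n then 1 else 0 := by
  have h := sum_fin_two_mul n fun x => if (σ x : ℕ) = i then 1 else 0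
  rw [pairWord, letterCount_ofFn]
  simp only [Nat.cast_inj]
  rw [← h, Equiv.sum_comp σ fun x => if (x : ℕ) = i then 1 else 0]
  split_ifs with hi
  · rw [Finset.sum_eq_single ⟨i, hi⟩] <;> simp +contextual [Fin.ext_iff]
  · exact Finset.sum_eq_zero fun x _ => if_neg (by omega)

theorem openPeaks_pairWord : openPeaks (pairWord σ) = 0 := by
  simp [pairWord, openPeaks_ofFn]

/-- Since the length is even, every position of even index has a smaller right neighbour, and the
last position is a valley. -/
theorem isPermMinimum_iff_odd (hσ : IsAlternatingPerm σ) (i : Fin (2 * n)) :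
    IsPermMinimum σ i ↔ Odd (i : ℕ) := by
  constructor
  · intro h
    by_contra hodd
    rw [Nat.not_odd_iff_even] at hodd
    obtain ⟨m, hm⟩ := hodd
    have hlt : (i : ℕ) + 1 < 2 * n := by omega
    exact lt_asymm (h ⟨i + 1, hlt⟩ (Or.inl rfl)) ((hσ i ⟨i + 1, hlt⟩ rfl).1 ⟨m, hm⟩)
  · rintro hodd j (hj | hj)
    · exact (hσ i j hj).2 hodd
    · refine (hσ j i hj).1 ?_
      rw [hj, Nat.odd_add_one, Nat.not_odd_iff_even] at hodd
      exact hodd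

theorem oddValleys_pairWord (hσ : IsAlternatingPerm σ) :
    oddValleys (pairWord σ) = evenMinimaCount σ := by
  classical
  have hset : {i : Fin (2 * n) | IsPermMinimum σ i ∧ Even ((σ i : ℕ) + 1)} =
      ↑(Finset.univ.filter fun i : Fin (2 * n) => Odd (i : ℕ) ∧ Odd (σ i : ℕ)) := by
    ext i
    simp [isPermMinimum_iff_odd hσ, Nat.even_add_one]
  rw [evenMinimaCount, hset, Set.ncard_coe_finset, Finset.card_filter,
    sum_fin_two_mul n, pairWord, oddValleys_ofFn]
  refine Finset.sum_congr rfl fun j _ => ?_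
  simp

theorem exists_pairWord_eq {l : List PeakValley} (hl : l ∈ partialWords (2 * n))
    (h0 : openPeaks l = 0) : ∃ σ : Equiv.Perm (Fin (2 * n)), pairWord σ = l := by
  obtain ⟨-, hcount⟩ := mem_partialWords.mp hl
  have hlen : l.length = n := by
    have := two_mul_length_eq (M := 2 * n) (l := l) fun i hi => by
      rw [hcount, if_neg (by omega)]
    rw [h0, Finset.sum_congr rfl (g := fun _ => 1) fun i hi => by
      rw [hcount, if_pos (Finset.mem_range.mp hi)]] at this
    simp at this
    omega
  subst hlen
  have hpeak : ∀ (l : List PeakValley), openPeaks l = 0 → ∀ (j : ℕ) (hj : j < l.length),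
      ∃ p : ℕ, l[j].1 = p := by
    intro l h0 j hj
    induction l generalizing j with
    | nil => simp at hj
    | cons a l ih =>
      simp only [openPeaks, Nat.add_eq_zero_iff] at h0
      rcases j with _ | j
      · obtain ⟨p, hp⟩ := WithTop.ne_top_iff_exists.mp
          (show a.1 ≠ ⊤ from fun e => by simp [e] at h0)
        exact ⟨p, hp.symm⟩
      · exact ih h0.2 j (by simpa using hj)
  choose p hp using hpeak l h0
  have hlt : ∀ (j : ℕ) (hj : j < l.length) (i : ℕ), (l[j].1 = i ∨ l[j].2 = i) →
      i < 2 * l.length := by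
    intro j hj i h
    have := letterCount_getElem_pos hj h
    rw [hcount] at this
    by_contra hi
    simp [hi] at this
  have hdiv : ∀ x : Fin (2 * l.length), (x : ℕ) / 2 < l.length := fun x => by omega
  let w : Fin (2 * l.length) → Fin (2 * l.length) := fun x =>
    if (x : ℕ) % 2 = 0 then ⟨p (x / 2) (hdiv x), hlt _ (hdiv x) _ (Or.inl (hp _ _))⟩
    else ⟨(l[(x : ℕ) / 2]'(hdiv x)).2, hlt _ (hdiv x) _ (Or.inr rfl)⟩
  have hw0 : ∀ (j : ℕ) (hj : j < l.length), (w ⟨2 * j, by omega⟩ : ℕ) = p j hj := by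
    intro j hj
    simp [w]
  have hw1 : ∀ (j : ℕ) (hj : j < l.length), (w ⟨2 * j + 1, by omega⟩ : ℕ) = l[j].2 := by
    intro j hj
    have h1 : (2 * j + 1) / 2 = j := by omega
    have h2 : (2 * j + 1) % 2 ≠ 0 := by omega
    simp [w, h1]
  -- Every letter occurs in `l`; on a finite set surjectivity suffices for a permutation.
  have hsurj : Function.Surjective w := by
    intro y
    obtain ⟨j, hj, h | h⟩ := letterCount_pos (i := y) (l := l) (by rw [hcount, if_pos y.2]; simp)
    · refine ⟨⟨2 * j, by omega⟩, Fin.ext ?_⟩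
      rw [hw0 j hj]
      exact Nat.cast_inj.mp ((hp j hj).symm.trans h)
    · exact ⟨⟨2 * j + 1, by omega⟩, Fin.ext ((hw1 j hj).trans h)⟩
  refine ⟨Equiv.ofBijective w (Finite.surjective_iff_bijective.mp hsurj), ?_⟩
  refine List.ext_getElem (by simp [pairWord]) fun j h1 h2 => ?_
  simp only [pairWord, List.getElem_ofFn, Equiv.ofBijective_apply]
  rw [hw0 j h2, hw1 j h2, ← hp j h2]

end PairWord

theorem coeff_list_sum_X_pow {ι : Type*} (L : List ι) (p : ι → Prop) [DecidablePred p]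
    (e : ι → ℕ) (k : ℕ) :
    ((L.map fun x => if p x then (Polynomial.X : ℝ[X]) ^ e x else 0).sum).coeff k =
      ((L.filter fun x => p x ∧ e x = k).length : ℝ) := by
  induction L with
  | nil => simp
  | cons x L ih =>
    rw [List.map_cons, List.sum_cons, Polynomial.coeff_add, ih, List.filter_cons]
    by_cases h1 : p x <;> by_cases h2 : e x = k <;>
      simp [h1, h2, Polynomial.coeff_X_pow, eq_comm (a := k), add_comm]

theorem coeff_cnMoment (n k : ℕ) : (cnMoment n 0).coeff k =
    (Nat.card {σ : Equiv.Perm (Fin (2 * n)) //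
      IsAlternatingPerm σ ∧ evenMinimaCount σ = k} : ℝ) := by
  classical
  rw [cnMoment_eq_wordPolynomial, mul_zero, wordPolynomial, coeff_list_sum_X_pow]
  set L := (partialWords (2 * n)).filter fun l => openPeaks l = 0 ∧ oddValleys l = k with hL
  have hnodup : L.Nodup := (nodup_partialWords _).filter _
  have hmem : ∀ l, l ∈ L ↔ l ∈ partialWords (2 * n) ∧ openPeaks l = 0 ∧ oddValleys l = k := by
    simp [hL]
  rw [← List.toFinset_card_of_nodup hnodup, ← Nat.card_eq_finsetCard, Nat.cast_inj]
  symm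
  refine Nat.card_congr (Equiv.ofBijective (fun σ => ⟨pairWord σ.1, ?_⟩) ⟨fun σ τ h => ?_, ?_⟩)
  · rw [List.mem_toFinset, hmem, oddValleys_pairWord σ.2.1]
    exact ⟨mem_partialWords.mpr ⟨isZigzag_pairWord.mpr σ.2.1, letterCount_pairWord⟩,
      openPeaks_pairWord, σ.2.2⟩
  · exact Subtype.ext (pairWord_injective (congrArg Subtype.val h))
  · rintro ⟨l, hl⟩
    rw [List.mem_toFinset, hmem] at hl
    obtain ⟨σ, rfl⟩ := exists_pairWord_eq hl.1 hl.2.1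
    have hσ := isZigzag_pairWord.mp (mem_partialWords.mp hl.1).1
    exact ⟨⟨σ, hσ, (oddValleys_pairWord hσ).symm.trans hl.2.2⟩, rfl⟩

/-! ### Even Taylor series from a chain of second derivatives -/

theorem hasDerivAt_mul_pow_div_factorial (a : ℝ) (n : ℕ) (x : ℝ) :
    HasDerivAt (fun x => a * x ^ (n + 1) / (n + 1).factorial) (a * x ^ n / n.factorial) x := by
  refine (((hasDerivAt_pow (n + 1) x).const_mul a).div_const _).congr_deriv ?_
  have : (n.factorial : ℝ) ≠ 0 := by positivity
  rw [Nat.factorial_succ]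
  push_cast
  field_simp

theorem abs_le_of_hasDerivAt_of_abs_le {f f' : ℝ → ℝ} {M : ℝ} {n : ℕ} (h0 : f 0 = 0)
    (hf : ∀ u, HasDerivAt f (f' u) u)
    (hf' : ∀ u, 0 ≤ u → |f' u| ≤ M * u ^ n / n.factorial) {u : ℝ} (hu : 0 ≤ u) :
    |f u| ≤ M * u ^ (n + 1) / (n + 1).factorial := by
  have hB := hasDerivAt_mul_pow_div_factorial M n
  exact image_norm_le_of_norm_deriv_right_le_deriv_boundary' (f := f) (a := 0) (b := u)
    (fun x _ => (hf x).continuousAt.continuousWithinAt) (fun x _ => (hf x).hasDerivWithinAt)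
    (by simp [h0]) (fun x _ => (hB x).continuousAt.continuousWithinAt)
    (fun x _ => (hB x).hasDerivWithinAt) (fun x hx => hf' x hx.1) ⟨hu, le_rfl⟩

/-- The Taylor remainder of a function given with the chain `g` of its (negated) second
derivatives. -/
theorem abs_sub_evenTaylor_le {g g' : ℕ → ℝ → ℝ} {M : ℕ → ℝ}
    (hg : ∀ n u, HasDerivAt (g n) (g' n u) u) (hg' : ∀ n u, HasDerivAt (g' n) (-g (n + 1) u) u)
    (h0 : ∀ n, g' n 0 = 0) (hM : ∀ n u, |g n u| ≤ M n) (N n : ℕ) {u : ℝ} (hu : 0 ≤ u) :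
    |g n u - ∑ i ∈ Finset.range N, (-1) ^ i * g (n + i) 0 * u ^ (2 * i) / (2 * i).factorial| ≤
      M (n + N) * u ^ (2 * N) / (2 * N).factorial := by
  induction N generalizing n u with
  | zero => simpa using hM n u
  | succ N ih =>
    -- Two derivatives turn the remainder of `g n` with `N + 1` terms into minus that of `g (n + 1)`
    -- with `N` terms; the bound is then integrated twice.
    have h1 : ∀ x, HasDerivAt (fun x => g' n x - ∑ i ∈ Finset.range N,
        (-1) ^ (i + 1) * g (n + (i + 1)) 0 * x ^ (2 * i + 1) / (2 * i + 1).factorial)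
        (-(g (n + 1) x - ∑ i ∈ Finset.range N,
          (-1) ^ i * g (n + 1 + i) 0 * x ^ (2 * i) / (2 * i).factorial)) x := by
      intro x
      refine ((hg' n x).sub (HasDerivAt.fun_sum fun i _ => hasDerivAt_mul_pow_div_factorial _ (2 * i) x)).congr_deriv ?_
      rw [neg_sub', ← Finset.sum_neg_distrib]
      congr 1
      refine Finset.sum_congr rfl fun i _ => ?_
      rw [show n + 1 + i = n + (i + 1) by ring]
      ring
    have h2 : ∀ x, HasDerivAt (fun x => g n x - ∑ i ∈ Finset.range (N + 1),
        (-1) ^ i * g (n + i) 0 * x ^ (2 * i) / (2 * i).factorial)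
        (g' n x - ∑ i ∈ Finset.range N,
          (-1) ^ (i + 1) * g (n + (i + 1)) 0 * x ^ (2 * i + 1) / (2 * i + 1).factorial) x := by
      intro x
      simp only [Finset.sum_range_succ' _ N]
      simp only [mul_zero, pow_zero]
      exact (hg n x).fun_sub ((HasDerivAt.fun_sum fun i _ =>
        hasDerivAt_mul_pow_div_factorial _ (2 * i + 1) x).add_const _)
    refine abs_le_of_hasDerivAt_of_abs_le (n := 2 * N + 1) ?_ h2 (fun x hx => ?_) hu
    · simp [Finset.sum_range_succ' _ N]
    · refine abs_le_of_hasDerivAt_of_abs_le (n := 2 * N) ?_ h1 (fun y hy => ?_) hx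
      · simp [h0]
      · rw [abs_neg, show n + (N + 1) = n + 1 + N by ring]
        exact ih (n + 1) hy

/-- The growth hypothesis bounds the remainder after `N` terms by `(4u²)ᴺ`, whence the radius `1/2`.
-/
theorem hasSum_evenTaylor {g g' : ℕ → ℝ → ℝ}
    (hg : ∀ n u, HasDerivAt (g n) (g' n u) u) (hg' : ∀ n u, HasDerivAt (g' n) (-g (n + 1) u) u)
    (h0 : ∀ n, g' n 0 = 0) (hM : ∀ n u, |g n u| ≤ 4 ^ n * (2 * n).factorial) {u : ℝ}
    (hu : |u| < 1 / 2) :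
    HasSum (fun n => (-1) ^ n * g n 0 * u ^ (2 * n) / (2 * n).factorial) (g 0 u) := by
  wlog hu0 : 0 ≤ u generalizing g g' u
  · have hsymm := this (g := fun n u => g n (-u)) (g' := fun n u => -g' n (-u)) (u := -u)
      (fun n x => ((hg n (-x)).comp x (hasDerivAt_neg x)).congr_deriv (by ring))
      (fun n x => ((hg' n (-x)).comp x (hasDerivAt_neg x)).neg.congr_deriv (by ring))
      (fun n => by simp [h0]) (fun n x => hM n (-x)) (by rwa [abs_neg]) (by linarith)
    simpa only [neg_zero, neg_neg, pow_mul, neg_sq] using hsymm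
  rw [abs_of_nonneg hu0] at hu
  have hr : 4 * u ^ 2 < 1 := by nlinarith
  have hr0 : 0 ≤ 4 * u ^ 2 := by positivity
  have hbound : ∀ n : ℕ, 4 ^ n * ((2 * n).factorial : ℝ) * u ^ (2 * n) / (2 * n).factorial =
      (4 * u ^ 2) ^ n := fun n => by
    have : ((2 * n).factorial : ℝ) ≠ 0 := by positivity
    rw [mul_pow, ← pow_mul]
    field_simp
  have hsum : Summable fun n => (-1) ^ n * g n 0 * u ^ (2 * n) / (2 * n).factorial := by
    refine Summable.of_norm_bounded (summable_geometric_of_lt_one hr0 hr) fun n => ?_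
    rw [Real.norm_eq_abs, abs_div, abs_mul, abs_mul, abs_pow, abs_neg, abs_one, one_pow, one_mul,
      abs_of_nonneg (pow_nonneg hu0 _), Nat.abs_cast, ← hbound]
    gcongr
    exact hM n 0
  rw [hsum.hasSum_iff_tendsto_nat, tendsto_iff_norm_sub_tendsto_zero]
  refine squeeze_zero (fun _ => norm_nonneg _) (fun N => ?_)
    (tendsto_pow_atTop_nhds_zero_of_lt_one hr0 hr)
  rw [norm_sub_rev, Real.norm_eq_abs, ← hbound]
  simpa using abs_sub_evenTaylor_le hg hg' h0 hM N 0 hu0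

theorem eq_of_hasSum_evenPowerSeries {a b : ℕ → ℝ} {f : ℝ → ℝ}
    (ha : ∀ᶠ u in nhds (0 : ℝ), HasSum (fun n => a n * u ^ (2 * n)) (f u))
    (hb : ∀ᶠ u in nhds (0 : ℝ), HasSum (fun n => b n * u ^ (2 * n)) (f u)) : a = b := by
  have key : ∀ {a : ℕ → ℝ}, (∀ᶠ u in nhds (0 : ℝ), HasSum (fun n => a n * u ^ (2 * n)) (f u)) →
      HasFPowerSeriesAt f (FormalMultilinearSeries.ofScalars ℝ
        fun m => if Even m then a (m / 2) else 0) 0 := by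
    intro a ha
    rw [hasFPowerSeriesAt_iff]
    filter_upwards [ha] with u hu
    rw [zero_add]
    refine (Function.Injective.hasSum_iff (g := fun n : ℕ => 2 * n)
      (fun m n h => by simpa using h) fun m hm => ?_).mp ?_
    · have : ¬ Even m := fun ⟨r, hr⟩ => hm ⟨r, by dsimp only; omega⟩
      simp [this]
    · have hterm : (fun n => a n * u ^ (2 * n)) = (fun n => u ^ n •
          (FormalMultilinearSeries.ofScalars ℝ fun m => if Even m then a (m / 2) else 0).coeff n) ∘
          fun n => 2 * n := by
        funext n
        simp [mul_comm]
      exact hterm ▸ hu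
  have h := (key ha).eq_formalMultilinearSeries (key hb)
  funext n
  have := congrArg (fun p => FormalMultilinearSeries.coeff p (2 * n)) h
  simpa using this

/-! ### The Jacobi elliptic functions -/

section Jacobi

variable {α : ℝ}

theorem one_sub_mul_sin_sq_pos (hα : |α| < 1) (t : ℝ) : 0 < 1 - α ^ 2 * Real.sin t ^ 2 := by
  have h1 : α ^ 2 < 1 := (sq_lt_one_iff_abs_lt_one α).mpr hα
  nlinarith [Real.sin_sq_le_one t, sq_nonneg (Real.sin t), sq_nonneg α]

theorem hasDerivAt_ellipticF (hα : |α| < 1) (φ : ℝ) :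
    HasDerivAt (ellipticF α) (1 / √(1 - α ^ 2 * Real.sin φ ^ 2)) φ := by
  have hc : Continuous fun t => 1 / √(1 - α ^ 2 * Real.sin t ^ 2) :=
    continuous_const.div (by fun_prop)
      fun t => (Real.sqrt_pos.mpr (one_sub_mul_sin_sq_pos hα t)).ne'
  exact intervalIntegral.integral_hasDerivAt_right (hc.intervalIntegrable _ _)
    (hc.stronglyMeasurableAtFilter _ _) hc.continuousAt

theorem ellipticF_zero : ellipticF α 0 = 0 := by simp [ellipticF]

theorem strictMono_ellipticF (hα : |α| < 1) : StrictMono (ellipticF α) :=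
  strictMono_of_deriv_pos fun φ => by
    rw [(hasDerivAt_ellipticF hα φ).deriv]
    have := Real.sqrt_pos.mpr (one_sub_mul_sin_sq_pos hα φ)
    positivity

/-- The integrand is at least `1`, so `ellipticF α φ - φ` is monotone and `ellipticF` is unbounded
in both directions. -/
theorem surjective_ellipticF (hα : |α| < 1) : Function.Surjective (ellipticF α) := by
  have hd : ∀ φ, HasDerivAt (fun φ => ellipticF α φ - φ)
      (1 / √(1 - α ^ 2 * Real.sin φ ^ 2) - 1) φ := fun φ =>
    (hasDerivAt_ellipticF hα φ).sub (hasDerivAt_id φ)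
  have hmono : Monotone fun φ => ellipticF α φ - φ := by
    refine monotone_of_deriv_nonneg (fun φ => (hd φ).differentiableAt) fun φ => ?_
    rw [(hd φ).deriv, sub_nonneg, le_div_iff₀ (Real.sqrt_pos.mpr (one_sub_mul_sin_sq_pos hα φ)),
      one_mul]
    refine Real.sqrt_le_one.mpr ?_
    nlinarith [mul_nonneg (sq_nonneg α) (sq_nonneg (Real.sin φ))]
  refine Continuous.surjective
    (continuous_iff_continuousAt.mpr fun φ => (hasDerivAt_ellipticF hα φ).continuousAt) ?_ ?_
  · refine Filter.tendsto_atTop_mono' _ ?_ Filter.tendsto_id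
    filter_upwards [Filter.eventually_ge_atTop 0] with φ hφ
    have := hmono hφ
    simp only [ellipticF_zero, id] at this ⊢
    linarith
  · refine Filter.tendsto_atBot_mono' _ ?_ Filter.tendsto_id
    filter_upwards [Filter.eventually_le_atBot 0] with φ hφ
    have := hmono hφ
    simp only [ellipticF_zero, id] at this ⊢
    linarith

theorem ellipticF_jacobiAm (hα : |α| < 1) (u : ℝ) : ellipticF α (jacobiAm α u) = u :=
  Function.rightInverse_invFun (surjective_ellipticF hα) u

theorem jacobiAm_ellipticF (hα : |α| < 1) (φ : ℝ) : jacobiAm α (ellipticF α φ) = φ :=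
  Function.leftInverse_invFun (strictMono_ellipticF hα).injective φ

theorem jacobiAm_zero (hα : |α| < 1) : jacobiAm α 0 = 0 := by
  simpa only [ellipticF_zero] using jacobiAm_ellipticF hα 0

theorem continuous_jacobiAm (hα : |α| < 1) : Continuous (jacobiAm α) := by
  refine Monotone.continuous_of_surjective (fun u v huv => ?_)
    fun φ => ⟨_, jacobiAm_ellipticF hα φ⟩
  rwa [← (strictMono_ellipticF hα).le_iff_le, ellipticF_jacobiAm hα, ellipticF_jacobiAm hα]

/-- The Jacobi elliptic function `sn(u, α) = sin am(u, α)`. -/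
noncomputable def jacobiSn (α u : ℝ) : ℝ := Real.sin (jacobiAm α u)

/-- The Jacobi elliptic function `dn(u, α) = √(1 - α² sn(u, α)²)`. -/
noncomputable def jacobiDn (α u : ℝ) : ℝ := √(1 - α ^ 2 * jacobiSn α u ^ 2)

theorem jacobiDn_pos (hα : |α| < 1) (u : ℝ) : 0 < jacobiDn α u :=
  Real.sqrt_pos.mpr (one_sub_mul_sin_sq_pos hα _)

theorem jacobiDn_sq (hα : |α| < 1) (u : ℝ) : jacobiDn α u ^ 2 = 1 - α ^ 2 * jacobiSn α u ^ 2 :=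
  Real.sq_sqrt (one_sub_mul_sin_sq_pos hα _).le

theorem jacobiCn_sq (α u : ℝ) : jacobiCn α u ^ 2 = 1 - jacobiSn α u ^ 2 := by
  rw [jacobiCn, jacobiSn, Real.cos_sq']

theorem hasDerivAt_jacobiAm (hα : |α| < 1) (u : ℝ) :
    HasDerivAt (jacobiAm α) (jacobiDn α u) u := by
  have h := HasDerivAt.of_local_left_inverse (continuous_jacobiAm hα).continuousAt
    (hasDerivAt_ellipticF hα (jacobiAm α u)) (one_div_pos.mpr (jacobiDn_pos hα u)).ne'
    (Filter.Eventually.of_forall (ellipticF_jacobiAm hα))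
  rwa [one_div, inv_inv] at h

theorem hasDerivAt_jacobiSn (hα : |α| < 1) (u : ℝ) :
    HasDerivAt (jacobiSn α) (jacobiCn α u * jacobiDn α u) u :=
  (hasDerivAt_jacobiAm hα u).sin

theorem hasDerivAt_jacobiCn (hα : |α| < 1) (u : ℝ) :
    HasDerivAt (jacobiCn α) (-jacobiSn α u * jacobiDn α u) u :=
  (hasDerivAt_jacobiAm hα u).cos

theorem hasDerivAt_jacobiDn (hα : |α| < 1) (u : ℝ) :
    HasDerivAt (jacobiDn α) (-α ^ 2 * jacobiSn α u * jacobiCn α u) u := by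
  have h := ((((hasDerivAt_jacobiSn hα u).pow 2).const_mul (α ^ 2)).const_sub 1).sqrt
    (one_sub_mul_sin_sq_pos hα _).ne'
  refine h.congr_deriv ?_
  have hd := (jacobiDn_pos hα u).ne'
  change _ / (2 * jacobiDn α u) = _
  push_cast
  field_simp

/-- The functions `(-1)ᵏ sn²ᵏ cn`, on which the second derivative acts tridiagonally. -/
noncomputable def snPowCn (α : ℝ) (k : ℕ) (u : ℝ) : ℝ :=
  (-1) ^ k * jacobiSn α u ^ (2 * k) * jacobiCn α u

/-- The derivative of `snPowCn`. -/
noncomputable def snPowCnDeriv (α : ℝ) (k : ℕ) (u : ℝ) : ℝ :=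
  (-1) ^ k * (2 * k * jacobiSn α u ^ (2 * k - 1) - (2 * k + 1) * jacobiSn α u ^ (2 * k + 1)) *
    jacobiDn α u

theorem hasDerivAt_snPowCn (hα : |α| < 1) (k : ℕ) (u : ℝ) :
    HasDerivAt (snPowCn α k) (snPowCnDeriv α k u) u := by
  refine ((((hasDerivAt_jacobiSn hα u).pow (2 * k)).const_mul ((-1) ^ k)).mul
    (hasDerivAt_jacobiCn hα u)).congr_deriv ?_
  have hc := jacobiCn_sq α u
  rw [snPowCnDeriv]
  rcases k with _ | k
  · simp
  · rw [show 2 * (k + 1) - 1 = 2 * k + 1 by omega]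
    push_cast
    simp only [Pi.pow_apply]
    linear_combination ((-1) ^ (k + 1) * (2 * k + 2) * jacobiSn α u ^ (2 * k + 1) *
      jacobiDn α u) * hc

/-- The outer factors `2k+1` and `2k` are row `k` of `L`, and the brackets are entries of `U`
applied to the column of functions. The sign `(-1)ᵏ` in `snPowCn` makes all matrix entries
nonnegative. -/
theorem hasDerivAt_snPowCnDeriv (hα : |α| < 1) (k : ℕ) (u : ℝ) :
    HasDerivAt (snPowCnDeriv α k)
      (-((2 * k + 1) * ((2 * k + 1) * snPowCn α k u + (2 * k + 2) * α ^ 2 * snPowCn α (k + 1) u) +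
        2 * k * ((2 * k - 1) * snPowCn α (k - 1) u + 2 * k * α ^ 2 * snPowCn α k u))) u := by
  have hs := hasDerivAt_jacobiSn hα u
  refine (((((hs.pow (2 * k - 1)).const_mul (2 * (k : ℝ))).sub
    ((hs.pow (2 * k + 1)).const_mul (2 * (k : ℝ) + 1))).const_mul ((-1) ^ k)).mul
    (hasDerivAt_jacobiDn hα u)).congr_deriv ?_
  have hd := jacobiDn_sq hα u
  simp only [snPowCn, Pi.pow_apply, Pi.sub_apply]
  rcases k with _ | k
  · simp
    linear_combination (-jacobiCn α u) * hd
  · rw [show 2 * (k + 1) - 1 = 2 * k + 1 by omega, Nat.add_sub_cancel, Nat.add_sub_cancel,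
      Nat.add_sub_cancel]
    push_cast
    linear_combination ((-1) ^ (k + 1) * ((2 * k + 2) * (2 * k + 1) * jacobiSn α u ^ (2 * k) -
      (2 * k + 3) ^ 2 * jacobiSn α u ^ (2 * k + 2)) * jacobiCn α u) * hd

theorem abs_snPowCn_le (α : ℝ) (k : ℕ) (u : ℝ) : |snPowCn α k u| ≤ 1 := by
  rw [snPowCn, abs_mul, abs_mul, abs_pow, abs_neg, abs_one, one_pow, one_mul, abs_pow]
  exact mul_le_one₀ (pow_le_one₀ (abs_nonneg _) (Real.abs_sin_le_one _)) (abs_nonneg _)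
    (Real.abs_cos_le_one _)

theorem snPowCn_zero (hα : |α| < 1) (k : ℕ) : snPowCn α k 0 = if k = 0 then 1 else 0 := by
  rcases k with _ | k <;> simp [snPowCn, jacobiSn, jacobiCn, jacobiAm_zero hα]

theorem snPowCnDeriv_zero (hα : |α| < 1) (k : ℕ) : snPowCnDeriv α k 0 = 0 := by
  rcases k with _ | k
  · simp [snPowCnDeriv, jacobiSn, jacobiAm_zero hα]
  · simp [snPowCnDeriv, jacobiSn, jacobiAm_zero hα, show 2 * (k + 1) - 1 = 2 * k + 1 by omega]

end Jacobi

/-! ### The Taylor coefficients of `cn` -/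

theorem eval_cnMoment_succ (n k : ℕ) (q : ℝ) : (cnMoment (n + 1) k).eval q =
    2 * k * q * ((2 * ((k - 1 : ℕ) : ℝ) + 1) * (cnMoment n (k - 1)).eval q +
      (2 * ((k - 1 : ℕ) : ℝ) + 2) * (cnMoment n (k - 1 + 1)).eval q) +
    (2 * k + 1) * ((2 * k + 1) * (cnMoment n k).eval q +
      (2 * k + 2) * (cnMoment n (k + 1)).eval q) := by
  rw [cnMoment, Function.iterate_succ_apply', ← cnMoment]
  simp [upperBidiag, lowerBidiag]

theorem cnMoment_eq_zero {n k : ℕ} (h : n < k) : cnMoment n k = 0 := by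
  induction n generalizing k with
  | zero => simp [cnMoment, h.ne']
  | succ n ih =>
    rw [cnMoment, Function.iterate_succ_apply', ← cnMoment]
    simp [upperBidiag, lowerBidiag, ih (show n < k - 1 by omega),
      ih (show n < k - 1 + 1 by omega), ih (show n < k by omega), ih (show n < k + 1 by omega)]

theorem eval_cnMoment_nonneg (n k : ℕ) {q : ℝ} (hq : 0 ≤ q) : 0 ≤ (cnMoment n k).eval q := by
  induction n generalizing k with
  | zero =>
    rcases k with _ | k <;> simp [cnMoment]
  | succ n ih =>
    rw [eval_cnMoment_succ]
    have := ih (k - 1)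
    have := ih (k - 1 + 1)
    have := ih k
    have := ih (k + 1)
    positivity

/-- Pairing with a sequence turns the row action defining `cnMoment` into the column action. -/
theorem sum_eval_cnMoment_succ_mul (n : ℕ) (q : ℝ) (y : ℕ → ℝ) :
    ∑ k ∈ Finset.range (n + 2), (cnMoment (n + 1) k).eval q * y k =
      ∑ k ∈ Finset.range (n + 1), (cnMoment n k).eval q *
        ((2 * k + 1) * ((2 * k + 1) * y k + (2 * k + 2) * q * y (k + 1)) +
          2 * k * ((2 * k - 1) * y (k - 1) + 2 * k * q * y k)) := by
  -- Index shifts move `U`, then `L`, across the pairing; the boundary terms vanish because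
  -- `cnMoment n` is supported on `k ≤ n`.
  have hupper : ∀ (m : ℕ) (h y : ℕ → ℝ),
      ∑ k ∈ Finset.range (m + 1), (2 * k * q * h (k - 1) + (2 * k + 1) * h k) * y k =
      ∑ k ∈ Finset.range m, h k * ((2 * k + 1) * y k + (2 * k + 2) * q * y (k + 1)) +
        (2 * m + 1) * h m * y m := by
    intro m h y
    induction m with
    | zero => simp
    | succ m ih =>
      rw [Finset.sum_range_succ, ih, Finset.sum_range_succ, Nat.add_sub_cancel]
      push_cast
      ring
  have hlower : ∀ (m : ℕ) (v z : ℕ → ℝ),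
      ∑ k ∈ Finset.range m, ((2 * k + 1) * v k + (2 * k + 2) * v (k + 1)) * z k =
      ∑ k ∈ Finset.range m, v k * ((2 * k + 1) * z k + 2 * k * z (k - 1)) +
        2 * m * v m * z (m - 1) := by
    intro m v z
    induction m with
    | zero => simp
    | succ m ih =>
      rw [Finset.sum_range_succ, ih, Finset.sum_range_succ, Nat.add_sub_cancel]
      push_cast
      ring
  have h1 := hupper (n + 1) (fun k => (2 * k + 1) * (cnMoment n k).eval q +
      (2 * k + 2) * (cnMoment n (k + 1)).eval q) y
  have h2 := hlower (n + 1) (fun k => (cnMoment n k).eval q)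
    (fun k => (2 * k + 1) * y k + (2 * k + 2) * q * y (k + 1))
  simp only [cnMoment_eq_zero (Nat.lt_succ_self n), cnMoment_eq_zero (show n < n + 1 + 1 by omega),
    Polynomial.eval_zero, mul_zero, zero_mul, add_zero] at h1 h2
  simp only [eval_cnMoment_succ]
  rw [h1, h2]
  refine Finset.sum_congr rfl fun k _ => ?_
  rcases k with _ | k
  · simp
  · rw [Nat.add_sub_cancel]
    push_cast
    ring

/-- Pairing with the constant `1` produces row sums of `B`. For `q ≤ 1` and `k ≤ n` these are at
most `4(2n+1)(2n+2)`, whose product builds up `4ⁿ (2n)!`. -/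
theorem sum_eval_cnMoment_le (n : ℕ) {q : ℝ} (hq : 0 ≤ q) (hq1 : q ≤ 1) :
    ∑ k ∈ Finset.range (n + 1), (cnMoment n k).eval q ≤ 4 ^ n * (2 * n).factorial := by
  induction n with
  | zero => simp [cnMoment]
  | succ n ih =>
    have h := sum_eval_cnMoment_succ_mul n q fun _ => 1
    simp only [mul_one] at h
    rw [h]
    have hle : ∀ k ∈ Finset.range (n + 1), (cnMoment n k).eval q *
        ((2 * k + 1) * (2 * k + 1 + (2 * k + 2) * q) + 2 * k * (2 * k - 1 + 2 * k * q)) ≤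
        (cnMoment n k).eval q * (4 * (2 * n + 1) * (2 * n + 2)) := by
      intro k hk
      refine mul_le_mul_of_nonneg_left ?_ (eval_cnMoment_nonneg n k hq)
      have hkn : (k : ℝ) ≤ n := by exact_mod_cast Nat.lt_succ_iff.mp (Finset.mem_range.mp hk)
      have hk0 : (0 : ℝ) ≤ k := Nat.cast_nonneg k
      have h1 : (2 * k + 1) * (2 * k + 1 + (2 * k + 2) * q) + 2 * k * (2 * k - 1 + 2 * k * q) ≤
          4 * (2 * (k : ℝ) + 1) * (2 * k + 2) := by
        nlinarith [mul_nonneg hk0 hk0, mul_nonneg hk0 (sub_nonneg.mpr hq1),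
          mul_nonneg (mul_nonneg hk0 hk0) (sub_nonneg.mpr hq1)]
      refine h1.trans ?_
      gcongr
    refine (Finset.sum_le_sum hle).trans ?_
    rw [← Finset.sum_mul, show 2 * (n + 1) = 2 * n + 1 + 1 by ring, Nat.factorial_succ,
      Nat.factorial_succ]
    push_cast
    calc _ ≤ 4 ^ n * ((2 * n).factorial : ℝ) * (4 * (2 * n + 1) * (2 * n + 2)) := by gcongr
      _ = _ := by ring

theorem isCnTaylorSequence_cnMoment : IsCnTaylorSequence fun n => cnMoment n 0 := by
  intro α hα
  have hq1 : α ^ 2 ≤ 1 := ((sq_lt_one_iff_abs_lt_one α).mpr hα).le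
  have h := fun u => hasSum_evenTaylor (u := u)
    (g := fun n u => ∑ k ∈ Finset.range (n + 1), (cnMoment n k).eval (α ^ 2) * snPowCn α k u)
    (g' := fun n u => ∑ k ∈ Finset.range (n + 1),
      (cnMoment n k).eval (α ^ 2) * snPowCnDeriv α k u)
    (fun n u => HasDerivAt.fun_sum fun k _ => (hasDerivAt_snPowCn hα k u).const_mul _)
    (fun n u => by
      refine (HasDerivAt.fun_sum fun k _ =>
        (hasDerivAt_snPowCnDeriv hα k u).const_mul _).congr_deriv ?_
      rw [sum_eval_cnMoment_succ_mul n (α ^ 2) fun k => snPowCn α k u, ← Finset.sum_neg_distrib]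
      exact Finset.sum_congr rfl fun k _ => mul_neg _ _)
    (fun n => by simp [snPowCnDeriv_zero hα])
    (fun n u => by
      refine (Finset.abs_sum_le_sum_abs _ _).trans
        ((Finset.sum_le_sum fun k _ => ?_).trans (sum_eval_cnMoment_le n (sq_nonneg α) hq1))
      rw [abs_mul, abs_of_nonneg (eval_cnMoment_nonneg n k (sq_nonneg α))]
      exact mul_le_of_le_one_right (eval_cnMoment_nonneg n k (sq_nonneg α)) (abs_snPowCn_le α k u))
  filter_upwards [Metric.ball_mem_nhds (0 : ℝ) (show (0 : ℝ) < 1 / 2 by norm_num)] with u hu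
  have hsum := h u (by simpa using hu)
  simp only [snPowCn_zero hα] at hsum
  simpa [cnMoment, snPowCn] using hsum

theorem IsCnTaylorSequence.eq {c c' : ℕ → ℝ[X]} (hc : IsCnTaylorSequence c)
    (hc' : IsCnTaylorSequence c') : c = c' := by
  have hform : ∀ {c : ℕ → ℝ[X]}, IsCnTaylorSequence c → ∀ α : ℝ, |α| < 1 →
      ∀ᶠ u in nhds (0 : ℝ), HasSum (fun n => ((-1) ^ n * (c n).eval (α ^ 2) /
        (2 * n).factorial) * u ^ (2 * n)) (jacobiCn α u) := by
    intro c hc α hα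
    filter_upwards [hc α hα] with u hu
    convert hu using 2 with n
    ring
  funext n
  -- Each `x` in `[0, 1)` is the square of the admissible modulus `√x`, so the polynomials agree at
  -- infinitely many points.
  refine Polynomial.eq_of_infinite_eval_eq _ _
    ((Set.Ico_infinite (show (0 : ℝ) < 1 by norm_num)).mono fun x hx => ?_)
  have hα : |√x| < 1 := by
    rw [abs_of_nonneg (Real.sqrt_nonneg x), Real.sqrt_lt' one_pos]
    simpa using hx.2
  have h := congrFun (eq_of_hasSum_evenPowerSeries (hform hc _ hα) (hform hc' _ hα)) n
  have hfac : ((2 * n).factorial : ℝ) ≠ 0 := by positivity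
  have hpow : ((-1 : ℝ) ^ n) ≠ 0 := by simp
  rw [div_left_inj' hfac, mul_right_inj' hpow, Real.sq_sqrt hx.1] at h
  exact h

theorem proposition4p6 :
    (∃! c : ℕ → ℝ[X], IsCnTaylorSequence c) ∧
    ∀ c : ℕ → ℝ[X], IsCnTaylorSequence c →
      (∀ n k : ℕ, (c n).coeff k =
        (Nat.card {σ : Equiv.Perm (Fin (2 * n)) //
          IsAlternatingPerm σ ∧ evenMinimaCount σ = k} : ℝ)) ∧
      IsQLogConvex 3 c := by
  refine ⟨⟨_, isCnTaylorSequence_cnMoment, fun c hc => hc.eq isCnTaylorSequence_cnMoment⟩,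
    fun c hc => ?_⟩
  rw [hc.eq isCnTaylorSequence_cnMoment]
  exact ⟨coeff_cnMoment, isQLogConvex_cnMoment⟩
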